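/- All fields have characteristic $0$ and all valuation rings are proper subrings of their fields. Let $(L,w)$ be a valued field of finite transcendence degree $\operatorname{td} L$ over $\mathbb{Q}$, with valuation ring $\mathcal{O}$, maximal ideal $\mathcal{M}$, value group $wL$ and residue field $\overline{L}$. The rank $\operatorname{rk} G$ of an ordered abelian group $G$ is the number of its proper convex subgroups. For $A\subseteq L$ let $\mathbb{Q}(A)^L$ be the algebraic closure in $L$ of the subfield $\mathbb{Q}(A)$ generated by $A$. For $r,t\in\mathcal{O}$ write $r\asymp t$ if there is an integer $n\ge 1$ with $w(r^n)\le w(t)\le w(r^{n+1})$ or $w(t^n)\le w(r)\le w(t^{n+1})$; write $r\ll t$ if $w(r)<w(t)$ and not $r\asymp t$. $(L,w)$ is prohenselian if, for every $m\ge 1$ and all nonzero $t_1,\dots,t_m\in\mathcal{M}$ with $t_1\ll\dots\ll t_m$, the valuation ring $\mathbb{Q}(t_1,\dots,t_m)^L\cap\mathcal{O}$ of $\mathbb{Q}(t_1,\dots,t_m)^L$ is contained in a henselian valuation ring that is a proper subring of $\mathbb{Q}(t_1,\dots,t_m)^L$. $(L,w)$ is flat if 1. $\operatorname{rk} wL\ge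 \operatorname{td} L$; and 2. if $\operatorname{char}\overline{L}=p>0$, then $w(p)$ lies in the smallest nonzero convex subgroup of $wL$ (that is, $(L,w)$ is tight), and if moreover $\operatorname{rk} wL=\operatorname{td} L$, then there is an element $t\in L$, transcendental over $\mathbb{Q}$, such that the value group of the restriction of $w$ to $\mathbb{Q}(t)^L$ has rank $1$. Proposition. If $(L,w)$ is flat and prohenselian, then $w$ is henselian. -/

import Mathlib

/-!
A valued field of characteristic zero is a field `L` together with a valuation ring
`O : ValuationSubring L`.  Its value group `wL` is `O.ValueGroupˣ`, written multiplicatively and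
with the order reversed: `w a ≤ w b` corresponds to `O.valuation b ≤ O.valuation a`.
-/

/-- A subgroup `H` of an ordered abelian group is convex if `1 ≤ a ≤ b` with `b ∈ H`
implies `a ∈ H`. -/
def IsConvexSubgroup {G : Type*} [CommGroup G] [LinearOrder G] (H : Subgroup G) : Prop :=
  ∀ a b : G, b ∈ H → 1 ≤ a → a ≤ b → a ∈ H

/-- The rank of an ordered abelian group: the number of its proper convex subgroups
(`⊤` if there are infinitely many). -/
noncomputable def convexRank (G : Type*) [CommGroup G] [LinearOrder G] : ℕ∞ :=
  Set.encard {H : Subgroup G | IsConvexSubgroup H ∧ H ≠ ⊤}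

/-- `ℚ(A)^L`: the relative algebraic closure in `L` of the subfield generated by `A`. -/
noncomputable def relAlgClosure {L : Type*} [Field L] [CharZero L] (A : Set L) : Subfield L :=
  (algebraicClosure (IntermediateField.adjoin ℚ A) L).toSubfield

namespace ValuationSubring

variable {L : Type*} [Field L]

/-- The rank of the value group. -/
noncomputable def valueRank (O : ValuationSubring L) : ℕ∞ :=
  convexRank (O.ValueGroup)ˣ

/-- The valuation ring `K ∩ O` of a subfield `K` of `L`. -/
def inter (O : ValuationSubring L) (K : Subfield L) : ValuationSubring K :=
  O.comap K.subtype

/-- `O` admits a henselian coarsening: some henselian valuation ring of `L`, a proper subring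
of `L`, contains `O`. -/
def HasHenselianCoarsening (O : ValuationSubring L) : Prop :=
  ∃ O' : ValuationSubring L, O ≤ O' ∧ O' ≠ ⊤ ∧ HenselianLocalRing O'

/-- `r ≍ t`: for some `n ≥ 1`, `w (r ^ n) ≤ w t ≤ w (r ^ (n + 1))`, or the same with `r` and `t`
exchanged. -/
def Comparable (O : ValuationSubring L) (r t : L) : Prop :=
  ∃ n : ℕ, 1 ≤ n ∧
    ((O.valuation t ≤ O.valuation (r ^ n) ∧ O.valuation (r ^ (n + 1)) ≤ O.valuation t) ∨
     (O.valuation r ≤ O.valuation (t ^ n) ∧ O.valuation (t ^ (n + 1)) ≤ O.valuation r))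

/-- `r ≪ t`: `r` and `t` are incomparable and `w r < w t`. -/
def MuchLess (O : ValuationSubring L) (r t : L) : Prop :=
  ¬ O.Comparable r t ∧ O.valuation t < O.valuation r

/-- `(L, w)` is of prohenselian degree `n`: for `1 ≤ m ≤ n` and all nonzero
`t₁ ≪ ⋯ ≪ tₘ` in the maximal ideal, `ℚ(t₁, …, tₘ)^L ∩ O` admits a henselian coarsening. -/
def IsProhenselianOfDegree [CharZero L] (O : ValuationSubring L) (n : ℕ) : Prop :=
  ∀ m : ℕ, 1 ≤ m → m ≤ n → ∀ t : Fin m → L,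
    (∀ i, t i ≠ 0 ∧ O.valuation (t i) < 1) →
    (∀ i j, i < j → O.MuchLess (t i) (t j)) →
    (O.inter (relAlgClosure (Set.range t))).HasHenselianCoarsening

/-- `(L, w)` is prohenselian if it is of prohenselian degree `n` for every `n`. -/
def IsProhenselian [CharZero L] (O : ValuationSubring L) : Prop :=
  ∀ n : ℕ, O.IsProhenselianOfDegree n

/-- `(L, w)` is tight (with respect to `p`): `w p` lies in the smallest nonzero convex subgroup
of the value group. -/
def IsTight (O : ValuationSubring L) (p : ℕ) : Prop :=
  ∃ H : Subgroup (O.ValueGroup)ˣ,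
    IsLeast {H : Subgroup (O.ValueGroup)ˣ | IsConvexSubgroup H ∧ H ≠ ⊥} H ∧
    ∃ γ ∈ H, (γ : O.ValueGroup) = O.valuation (p : L)

/-- `(L, w)` is flat. -/
def IsFlat [CharZero L] (O : ValuationSubring L) : Prop :=
  Cardinal.toENat (Algebra.trdeg ℚ L) ≤ O.valueRank ∧
  ∀ p : ℕ, 0 < p → CharP (IsLocalRing.ResidueField O) p →
    O.IsTight p ∧
    (O.valueRank = Cardinal.toENat (Algebra.trdeg ℚ L) →
      ∃ t : L, Transcendental ℚ t ∧ (O.inter (relAlgClosure {t})).valueRank = 1)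

end ValuationSubring

/-! The proof descends through henselian coarsenings of `O`, from the trivial one down to `O`. Fix a
coarsening `A` of `O`, a subfield `F` on which `A` is trivial, and nonunits `s i` of `A` in pairwise
distinct archimedean classes, at least as many as the transcendence degree of `L` over `F`.
Monomials in the `s i` have distinct values, so the `s i` are algebraically independent over `F` and
every nonunit of `A` shares its class with some `s i` (`exists_not_farBelow`).

Let `B ≠ O` be a henselian coarsening of `A`, and let `S` index the `s i` that are units of `B`.
Then `B` is trivial on `F(s i : i ∈ S)`. An equality of Abhyankar type makes the residue field of
`B` algebraic over this field, and Hensel's lemma lifts it to the relative algebraic closure `K` in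
`L` (`isAlgebraic_lift_of_farBelow`). Prohenselianity gives a henselian coarsening of `K ∩ O`;
composing it with `B` gives a strictly smaller henselian ring containing `O`
(`exists_henselian_refinement`). Each such step turns some unit `s i` into a nonunit, so the descent
reaches `O` (`henselian_of_farBelow`).

Convex subgroups supply the `s i`. In residue characteristic zero, `F = ℚ` and `A = O`. In
characteristic `p`, `A` is the least proper coarsening, obtained by inverting an element `π` of the
class of `p`, and `F = ℚ(π)`. Only classes beyond that of `π` are then available. The lost class is
made up either by rank exceeding transcendence degree, with `π = p`, or by a transcendental `π`. -/

/-- `x` is smaller than every power of `y`. -/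
def FarBelow {Γ : Type*} [Monoid Γ] [LT Γ] (x y : Γ) : Prop := ∀ n : ℕ, x < y ^ n

/-! ### Monomials in elements of distinct archimedean classes. -/

section FarBelow

/-- The square of the smaller factor is at most the product, so doubling the exponent suffices. -/
theorem FarBelow.mul {Γ : Type*} [CommMonoid Γ] [LinearOrder Γ] [IsOrderedMonoid Γ] {a x y : Γ}
    (hx : FarBelow a x) (hy : FarBelow a y) : FarBelow a (x * y) := by
  intro n
  rcases le_total x y with h | h
  · refine (hx (n * 2)).trans_le ?_
    rw [mul_comm, pow_mul]
    exact pow_le_pow_left' (by rw [pow_two]; exact mul_le_mul_right h x) n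
  · refine (hy (n * 2)).trans_le ?_
    rw [mul_comm, pow_mul]
    exact pow_le_pow_left' (by rw [pow_two]; exact mul_le_mul_left h y) n

theorem FarBelow.lt {Γ : Type*} [Monoid Γ] [LT Γ] {x y : Γ} (h : FarBelow x y) : x < y := by
  simpa using h 1

/-- Monomials in elements that are pairwise far from each other are distinct. -/
theorem injective_prod_pow_of_farBelow {Γ : Type*} [LinearOrderedCommGroupWithZero Γ]
    {ι : Type*} [Fintype ι] (g : ι → Γ)
    (h0 : ∀ i, g i ≠ 0) (h1 : ∀ i, g i < 1)
    (hg : ∀ i j, i ≠ j → FarBelow (g i) (g j) ∨ FarBelow (g j) (g i)) :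
    Function.Injective fun α : ι → ℕ => ∏ i, g i ^ α i := by
  classical
  -- At the smallest `g i` with differing exponents, one extra factor `g i` outweighs everything the
  -- other differing factors contribute, since `g i` is far below their product.
  have key : ∀ (α β : ι → ℕ) (i : ι), β i < α i →
      (∀ j, α j ≠ β j → g i ≤ g j) → ∏ i, g i ^ α i ≠ ∏ i, g i ^ β i := by
    intro α β i hi hmin heq
    set D : Finset ι := Finset.univ.filter fun j => α j ≠ β j with hD
    have hiD : i ∈ D := by simp [hD, hi.ne']
    have hsplit : ∀ γ : ι → ℕ, ∏ j, g j ^ γ j =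
        g i ^ γ i * (∏ j ∈ D.erase i, g j ^ γ j) * ∏ j ∈ Dᶜ, g j ^ γ j := by
      intro γ
      rw [Finset.mul_prod_erase D (fun j => g j ^ γ j) hiD, Finset.prod_mul_prod_compl]
    rw [hsplit α, hsplit β] at heq
    have hc : ∏ j ∈ Dᶜ, g j ^ α j = ∏ j ∈ Dᶜ, g j ^ β j := by
      refine Finset.prod_congr rfl fun j hj => ?_
      have : α j = β j := by simpa [hD] using hj
      rw [this]
    have hcne : ∏ j ∈ Dᶜ, g j ^ β j ≠ 0 :=
      Finset.prod_ne_zero_iff.2 fun j _ => pow_ne_zero _ (h0 j)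
    rw [hc, mul_left_inj' hcne] at heq
    have hfar : FarBelow (g i) (∏ j ∈ D.erase i, g j ^ β j) := by
      refine Finset.prod_induction _ (FarBelow (g i)) (fun _ _ => FarBelow.mul)
        (fun n => by simpa using h1 i) fun j hj => ?_
      obtain ⟨hji, hjD⟩ := Finset.mem_erase.1 hj
      have hjD' : α j ≠ β j := by simpa [hD] using hjD
      have : FarBelow (g i) (g j) := (hg i j hji.symm).resolve_right fun h =>
        absurd h.lt (not_lt.2 (hmin j hjD'))
      intro n
      rw [← pow_mul]
      exact this _
    have hle : g i ^ α i * ∏ j ∈ D.erase i, g j ^ α j ≤ g i ^ β i * g i := by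
      rw [← pow_succ]
      calc g i ^ α i * ∏ j ∈ D.erase i, g j ^ α j ≤ g i ^ α i * 1 := by
            gcongr
            exact Finset.prod_le_one' fun j _ => pow_le_one' (h1 j).le _
        _ ≤ g i ^ (β i + 1) := by
            rw [mul_one]
            exact pow_le_pow_right_of_le_one' (h1 i).le hi
    rw [heq] at hle
    exact absurd (hle.trans_lt (mul_lt_mul_of_pos_left hfar.lt
      (zero_lt_iff.2 (pow_ne_zero _ (h0 i))))) (lt_irrefl _)
  intro α β heq
  by_contra hne
  obtain ⟨k, hk⟩ := Function.ne_iff.1 hne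
  obtain ⟨i, hi, hmin⟩ := Finset.exists_min_image (Finset.univ.filter fun j => α j ≠ β j) g
    ⟨k, by simpa using hk⟩
  have hi' : α i ≠ β i := by simpa using hi
  have hmin' : ∀ j, α j ≠ β j → g i ≤ g j := fun j hj => hmin j (by simpa using hj)
  rcases hi'.lt_or_gt with h | h
  · exact key β α i h (fun j hj => hmin' j hj.symm) heq.symm
  · exact key α β i h hmin' heq

end FarBelow

/-! ### Values in a valuation ring and in its coarsenings. -/

namespace ValuationSubring

variable {L : Type*} [Field L]

theorem valuation_le_of_le {A B : ValuationSubring L} (h : A ≤ B) {x y : L}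
    (hxy : A.valuation x ≤ A.valuation y) : B.valuation x ≤ B.valuation y := by
  simpa only [mapOfLE_valuation_apply] using monotone_mapOfLE A B h hxy

theorem valuation_lt_of_le {A B : ValuationSubring L} (h : A ≤ B) {x y : L}
    (hxy : B.valuation x < B.valuation y) : A.valuation x < A.valuation y :=
  lt_of_not_ge fun hle => hxy.not_ge (valuation_le_of_le h hle)

theorem valuation_eq_one_of_le {A B : ValuationSubring L} (h : A ≤ B) {x : L}
    (hx : A.valuation x = 1) : B.valuation x = 1 := by
  rw [← mapOfLE_valuation_apply A B h, hx, map_one]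

/-- Coarsening weakens `<` to `≤`; one more factor `y`, still of value below `1` in `B`, restores
strictness. -/
theorem farBelow_of_le {A B : ValuationSubring L} (h : A ≤ B) {x y : L} (hy0 : y ≠ 0)
    (hy : B.valuation y < 1) (hxy : FarBelow (A.valuation x) (A.valuation y)) :
    FarBelow (B.valuation x) (B.valuation y) := by
  intro n
  have h1 : B.valuation x ≤ B.valuation (y ^ (n + 1)) :=
    valuation_le_of_le h (by rw [map_pow]; exact (hxy _).le)
  refine h1.trans_lt ?_
  rw [map_pow, pow_succ]
  exact mul_lt_of_lt_one_right (zero_lt_iff.2 (pow_ne_zero _ (by simpa using hy0))) hy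

/-! ### Valuation rings that are trivial on a subfield. -/

section Trivial

variable {k : Type*} [Field k] [Algebra k L] {A : ValuationSubring L}

theorem valuation_algebraMap_eq_one (hk : ∀ a : k, algebraMap k L a ∈ A) {a : k} (ha : a ≠ 0) :
    A.valuation (algebraMap k L a) = 1 := by
  refine le_antisymm ((A.valuation_le_one_iff _).2 (hk a)) ?_
  have h := (A.valuation_le_one_iff _).2 (hk a⁻¹)
  rw [map_inv₀, map_inv₀] at h
  rwa [inv_le_one₀ (zero_lt_iff.2 (by simpa using ha))] at h

/-- If monomials in `s` have distinct values, then a polynomial in `s` with trivially valued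
coefficients has the value of one of its monomials. -/
theorem exists_valuation_aeval_eq {ι : Type*} [Fintype ι] {s : ι → L}
    (hk : ∀ a : k, algebraMap k L a ∈ A)
    (hs : Function.Injective fun α : ι → ℕ => ∏ i, A.valuation (s i) ^ α i)
    {p : MvPolynomial ι k} (hp : p ≠ 0) :
    ∃ α : ι → ℕ, A.valuation (MvPolynomial.aeval s p) = ∏ i, A.valuation (s i) ^ α i := by
  classical
  have hval : ∀ d ∈ p.support,
      A.valuation (algebraMap k L (p.coeff d) * ∏ i, s i ^ d i) = ∏ i, A.valuation (s i) ^ d i := by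
    intro d hd
    rw [map_mul, valuation_algebraMap_eq_one hk (MvPolynomial.mem_support_iff.1 hd), one_mul,
      map_prod]
    simp
  obtain ⟨d, hd, hmax⟩ := Finset.exists_max_image p.support
    (fun d => ∏ i, A.valuation (s i) ^ d i) (by simpa using hp)
  refine ⟨d, ?_⟩
  rw [MvPolynomial.aeval_def, MvPolynomial.eval₂_eq', ← hval d hd]
  refine Valuation.map_sum_eq_of_lt A.valuation
    (f := fun d : ι →₀ ℕ => algebraMap k L (p.coeff d) * ∏ i, s i ^ d i) hd ?_
  intro e he
  obtain ⟨he, hne⟩ := Finset.mem_sdiff.1 he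
  rw [hval d hd, hval e he]
  refine lt_of_le_of_ne (hmax e he) fun h => hne ?_
  rw [Finset.mem_singleton]
  exact DFunLike.coe_injective (hs h)

theorem algebraicIndependent_of_injective {ι : Type*} [Fintype ι] {s : ι → L}
    (hk : ∀ a : k, algebraMap k L a ∈ A) (h0 : ∀ i, s i ≠ 0)
    (hs : Function.Injective fun α : ι → ℕ => ∏ i, A.valuation (s i) ^ α i) :
    AlgebraicIndependent k s := by
  rw [algebraicIndependent_iff]
  intro p hp
  by_contra hne
  obtain ⟨α, h⟩ := exists_valuation_aeval_eq hk hs hne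
  rw [hp, map_zero] at h
  exact Finset.prod_ne_zero_iff.2 (fun i _ => pow_ne_zero _ (by simpa using h0 i)) h.symm

/-- Distinctness of monomials is needed only in `A`: a nonzero polynomial in `s` has the `A`-value
of a monomial, and this becomes `1` in `B`. -/
theorem adjoin_range_le_of_injective {ι : Type*} [Fintype ι] {s : ι → L} {B : ValuationSubring L}
    (hAB : A ≤ B) (hk : ∀ a : k, algebraMap k L a ∈ A)
    (hs : Function.Injective fun α : ι → ℕ => ∏ i, A.valuation (s i) ^ α i)
    (hB : ∀ i, B.valuation (s i) = 1) {x : L} (hx : x ∈ IntermediateField.adjoin k (Set.range s)) :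
    x ∈ B := by
  have key : ∀ p : MvPolynomial ι k, p ≠ 0 → B.valuation (MvPolynomial.aeval s p) = 1 := by
    intro p hp
    obtain ⟨α, h⟩ := exists_valuation_aeval_eq hk hs hp
    rw [← mapOfLE_valuation_apply A B hAB, h, map_prod]
    simp [hB]
  obtain ⟨p, q, rfl⟩ := (IntermediateField.mem_adjoin_range_iff k s x).1 hx
  by_cases hp : p = 0
  · simp [hp, B.zero_mem]
  by_cases hq : q = 0
  · simp [hq, B.zero_mem]
  rw [← valuation_le_one_iff, map_div₀, key p hp, key q hq, div_one]

/-- Valuation rings are integrally closed. -/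
theorem mem_of_isAlgebraic (hk : ∀ a : k, algebraMap k L a ∈ A) {x : L} (hx : IsAlgebraic k x) :
    x ∈ A := by
  let : Algebra k A := ((algebraMap k L).codRestrict A.toSubring hk).toAlgebra
  have : IsScalarTower k A L := IsScalarTower.of_algebraMap_eq fun _ => rfl
  obtain ⟨a, ha⟩ := (IsIntegrallyClosed.isIntegral_iff (R := A) (K := L)).1
    (hx.isIntegral.tower_top (A := A))
  rw [← ha]
  exact a.2

/-- Over a trivially valued field of characteristic zero, residually algebraic elements of a
henselian valuation ring are congruent to algebraic elements. -/
theorem exists_isAlgebraic_sub_mem [CharZero k] (hk : ∀ a : k, algebraMap k L a ∈ A)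
    (hA : HenselianLocalRing A) {x : L} (hx : x ∈ A) {g : Polynomial k} (hg : g ≠ 0)
    (hgx : A.valuation (Polynomial.aeval x g) < 1) :
    ∃ a : L, IsAlgebraic k a ∧ A.valuation (a - x) < 1 := by
  let : Algebra k A := ((algebraMap k L).codRestrict A.toSubring hk).toAlgebra
  have : IsScalarTower k A L := IsScalarTower.of_algebraMap_eq fun _ => rfl
  have hmem : ∀ q : Polynomial k, A.valuation (Polynomial.aeval x q) ≤ 1 := by
    intro q
    have : Polynomial.aeval x q = algebraMap A L (Polynomial.aeval (⟨x, hx⟩ : A) q) := by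
      rw [← Polynomial.aeval_algebraMap_apply]; rfl
    rw [this]
    exact A.valuation_le_one _
  -- All factors of `g` take values at most `1` at `x`, so some irreducible factor takes a value
  -- below `1`.
  obtain ⟨f, hf, hfx⟩ : ∃ f : Polynomial k, Irreducible f ∧
      A.valuation (Polynomial.aeval x f) < 1 := by
    clear hA
    induction g using WfDvdMonoid.induction_on_irreducible with
    | zero => exact absurd rfl hg
    | unit u hu =>
      obtain ⟨v, hv⟩ := hu.exists_right_inv
      have h1 : A.valuation (Polynomial.aeval x u) * A.valuation (Polynomial.aeval x v) = 1 := by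
        rw [← map_mul, ← map_mul, hv, map_one, map_one]
      exact absurd (mul_lt_one_of_lt_of_le hgx (hmem v)) (by rw [h1]; exact lt_irrefl _)
    | mul a i ha hi ih =>
      rw [map_mul, map_mul] at hgx
      by_cases h : A.valuation (Polynomial.aeval x i) < 1
      · exact ⟨i, hi, h⟩
      · rw [le_antisymm (hmem i) (not_lt.1 h), one_mul] at hgx
        exact ih ha hgx
  obtain ⟨f, hf, hfm, hfx⟩ : ∃ f : Polynomial k, Irreducible f ∧ f.Monic ∧
      A.valuation (Polynomial.aeval x f) < 1 := by
    have hl : (f.leadingCoeff)⁻¹ ≠ 0 := inv_ne_zero (Polynomial.leadingCoeff_ne_zero.2 hf.ne_zero)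
    refine ⟨f * Polynomial.C f.leadingCoeff⁻¹, ?_, Polynomial.monic_mul_leadingCoeff_inv hf.ne_zero,
      ?_⟩
    · exact (irreducible_mul_isUnit (Polynomial.isUnit_C.2 hl.isUnit)).2 hf
    · rw [map_mul, map_mul]
      exact mul_lt_one_of_lt_of_le hfx (hmem _)
  -- Characteristic zero enters here: the Bézout relation between `f` and its derivative makes the
  -- derivative a unit at `x`.
  obtain ⟨a, b, hab⟩ := hf.separable
  have hder : A.valuation (Polynomial.aeval x (Polynomial.derivative f)) = 1 := by
    refine le_antisymm (hmem _) (not_lt.1 fun hlt => ?_)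
    have h1 : A.valuation (Polynomial.aeval x (a * f + b * Polynomial.derivative f)) < 1 := by
      rw [map_add, map_mul, map_mul]
      refine Valuation.map_add_lt _ ?_ ?_
      · rw [map_mul, mul_comm]; exact mul_lt_one_of_lt_of_le hfx (hmem _)
      · rw [map_mul, mul_comm]; exact mul_lt_one_of_lt_of_le hlt (hmem _)
    rw [hab, map_one, map_one] at h1
    exact lt_irrefl _ h1
  have heval : ∀ q : Polynomial k, ((Polynomial.eval (⟨x, hx⟩ : A) (q.map (algebraMap k A)) : A) : L)
      = Polynomial.aeval x q := by
    intro q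
    rw [Polynomial.eval_map_algebraMap]
    exact (Polynomial.aeval_algebraMap_apply L (⟨x, hx⟩ : A) q).symm
  obtain ⟨r, hr, hrx⟩ := hA.is_henselian (f.map (algebraMap k A)) (hfm.map _) ⟨x, hx⟩
    ((A.valuation_lt_one_iff _).2 (by rw [heval]; exact hfx))
    ((A.valuation_eq_one_iff _).2 (by rw [Polynomial.derivative_map, heval]; exact hder))
  refine ⟨r, ⟨f, hf.ne_zero, ?_⟩, (A.valuation_lt_one_iff _).1 hrx⟩
  rw [Polynomial.IsRoot.def, Polynomial.eval_map_algebraMap] at hr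
  have := Polynomial.aeval_algebraMap_apply L r f
  rw [hr, map_zero] at this
  exact this

end Trivial

end ValuationSubring

theorem IntermediateField.trdeg_add_trdeg_eq {F L : Type*} [Field F] [Field L] [Algebra F L]
    (E : IntermediateField F L) : Algebra.trdeg F E + Algebra.trdeg E L = Algebra.trdeg F L :=
  trdeg_add_eq F E

theorem IntermediateField.one_le_trdeg_adjoin_simple {F L : Type*} [Field F] [Field L] [Algebra F L]
    {x : L} (hx : Transcendental F x) : 1 ≤ Algebra.trdeg F (IntermediateField.adjoin F {x}) := by
  rw [Cardinal.one_le_iff_ne_zero, Ne, trdeg_eq_zero_iff]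
  intro halg
  exact hx ((isAlgebraic_algebraMap_iff
    (algebraMap (IntermediateField.adjoin F {x}) L).injective).2
    (halg.isAlgebraic ⟨x, IntermediateField.mem_adjoin_simple_self F x⟩))

/-! ### Composition of henselian valuation rings. -/

namespace ValuationSubring

variable {L : Type*} [Field L]

theorem valuation_lt_one_of_le {A B : ValuationSubring L} (h : A ≤ B) {x : L}
    (hx : B.valuation x < 1) : A.valuation x < 1 := by
  simpa using valuation_lt_of_le (x := x) (y := 1) h (by rw [map_one]; exact hx)

theorem exists_valuation_lt_one_eq_one {C B : ValuationSubring L} (h : C ≤ B) (hne : C ≠ B) :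
    ∃ y : L, y ≠ 0 ∧ C.valuation y < 1 ∧ B.valuation y = 1 := by
  obtain ⟨x, hxB, hxC⟩ := SetLike.exists_of_lt (lt_of_le_of_ne h hne)
  have hx0 : x ≠ 0 := fun h0 => hxC (h0 ▸ C.zero_mem)
  have hC : C.valuation x⁻¹ < 1 := by
    rw [map_inv₀]
    exact inv_lt_one_of_one_lt₀ (not_le.1 (mt (C.valuation_le_one_iff x).1 hxC))
  refine ⟨x⁻¹, inv_ne_zero hx0, hC, le_antisymm ?_ ?_⟩
  · simpa using valuation_le_of_le (x := x⁻¹) (y := 1) h (by rw [map_one]; exact hC.le)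
  · rw [map_inv₀, one_le_inv₀ (zero_lt_iff.2 (by simpa using hx0))]
    exact (B.valuation_le_one_iff x).2 hxB

/-- A henselian valuation ring that has a subfield of representatives for its residue field can be
refined along a henselian valuation ring of that subfield. -/
theorem exists_henselian_refinement {O B : ValuationSubring L} (hOB : O ≤ B)
    (hB : HenselianLocalRing B) (K : Subfield L) (hK : ∀ x ∈ K, x ∈ B)
    (hlift : ∀ x ∈ B, ∃ a ∈ K, B.valuation (a - x) < 1)
    (hcoarse : (O.inter K).HasHenselianCoarsening) :
    ∃ C : ValuationSubring L, O ≤ C ∧ C ≤ B ∧ C ≠ B ∧ HenselianLocalRing C := by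
  obtain ⟨B', hle, hne, hB'⟩ := hcoarse
  let φ : K →+* IsLocalRing.ResidueField B :=
    (IsLocalRing.residue B).comp (K.subtype.codRestrict B.toSubring fun x => hK x x.2)
  have hφ : Function.Bijective φ := by
    refine ⟨φ.injective, fun y => ?_⟩
    obtain ⟨x, rfl⟩ := IsLocalRing.residue_surjective y
    obtain ⟨a, haK, ha⟩ := hlift x x.2
    refine ⟨⟨a, haK⟩, ?_⟩
    rw [← sub_eq_zero, RingHom.comp_apply, ← map_sub, IsLocalRing.residue_eq_zero_iff]
    exact (B.valuation_lt_one_iff _).2 ha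
  let e := RingEquiv.ofBijective φ hφ
  let ρ : B →+* K := e.symm.toRingHom.comp (IsLocalRing.residue B)
  have hρK : ∀ a : K, ρ ⟨a, hK a a.2⟩ = a := fun a => e.symm_apply_apply a
  have hρ0 : ∀ x : B, ρ x = 0 ↔ x ∈ IsLocalRing.maximalIdeal B := by
    intro x
    rw [← IsLocalRing.residue_eq_zero_iff]
    exact e.symm.map_eq_zero_iff
  -- `ρ` retracts `B` onto its field of representatives `K`; the preimage of `B'` is the ring of the
  -- composite place.
  let T : Subring L := (B'.toSubring.comap ρ).map B.subtype
  have hT : ∀ x : L, x ∈ T ↔ ∃ h : x ∈ B, ρ ⟨x, h⟩ ∈ B' := by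
    intro x
    constructor
    · rintro ⟨y, hy, rfl⟩
      exact ⟨y.2, hy⟩
    · rintro ⟨h, hx⟩
      exact ⟨⟨x, h⟩, hx, rfl⟩
  have hOT : O.toSubring ≤ T := by
    intro x hx
    have hxB : x ∈ B := hOB hx
    refine (hT x).2 ⟨hxB, hle ?_⟩
    change ((ρ ⟨x, hxB⟩ : K) : L) ∈ O
    -- `x - ρ x` is a nonunit of `B`, hence lies in `O`, and so does `ρ x`.
    have h1 : (⟨x, hxB⟩ - ⟨ρ ⟨x, hxB⟩, hK _ (ρ ⟨x, hxB⟩).2⟩ : B) ∈ IsLocalRing.maximalIdeal B := by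
      rw [← hρ0, map_sub, hρK, sub_self]
    have h2 := valuation_lt_one_of_le hOB ((B.valuation_lt_one_iff _).1 h1)
    have h3 := O.sub_mem hx ((O.valuation_le_one_iff _).1 h2.le)
    simpa using h3
  let C : ValuationSubring L := ofLE O T hOT
  have hC : ∀ x : L, x ∈ C ↔ ∃ h : x ∈ B, ρ ⟨x, h⟩ ∈ B' := hT
  have hCB : C ≤ B := fun x hx => ((hC x).1 hx).1
  refine ⟨C, hOT, hCB, ?_, ?_⟩
  · intro hEq
    refine hne (top_le_iff.1 fun a _ => ?_)
    obtain ⟨h, ha⟩ := (hC a).1 (hEq.symm ▸ hK a a.2)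
    rwa [hρK] at ha
  let ι : C →+* B := C.inclusion B hCB
  have hι : Function.Injective ι := fun x y h => Subtype.ext (congrArg Subtype.val h :)
  let ψ : C →+* B' := (ρ.comp ι).codRestrict B'.toSubring fun x => ((hC x).1 x.2).2
  have hψ : ∀ c : C, (ψ c : K) = ρ (ι c) := fun _ => rfl
  have hlocal : ∀ c : C, IsUnit (ψ c) → IsUnit c := by
    intro c hc
    obtain ⟨d, hd⟩ := hc.exists_right_inv
    have hu : IsUnit (ι c) := by
      by_contra hu
      have h0 : ψ c = 0 := Subtype.ext ((hρ0 _).2 hu)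
      rw [h0, zero_mul] at hd
      exact zero_ne_one hd
    obtain ⟨y, hy⟩ := hu.exists_right_inv
    have hyd : ρ y = d := by
      have h1 : ρ (ι c) * ρ y = 1 := by rw [← map_mul, hy, map_one]
      have h2 : ρ (ι c) * d = 1 := congrArg Subtype.val hd
      have h3 : ρ (ι c) ≠ 0 := left_ne_zero_of_mul_eq_one h2
      exact mul_left_cancel₀ h3 (h1.trans h2.symm)
    have hyC : (y : L) ∈ C := (hC y).2 ⟨y.2, by rw [Subtype.coe_eta, hyd]; exact d.2⟩
    exact IsUnit.of_mul_eq_one ⟨y, hyC⟩ (Subtype.ext (congrArg Subtype.val hy :))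
  refine { toIsLocalRing := inferInstance, is_henselian := fun f hf a₀ ha₀ hda₀ => ?_ }
  have hψmem : ∀ c : C, c ∈ IsLocalRing.maximalIdeal C → ψ c ∈ IsLocalRing.maximalIdeal B' :=
    fun c hc h => hc (hlocal c h)
  -- Hensel's lemma in two stages: a root `b` in `B'`, viewed in `K`, serves as approximate root
  -- over `B`; the exact root found there still has image `b`.
  obtain ⟨b, hb, hba⟩ := hB'.is_henselian (f.map ψ) (hf.map ψ) (ψ a₀)
    (by rw [Polynomial.eval_map_apply]; exact hψmem _ ha₀)
    (by rw [Polynomial.derivative_map, Polynomial.eval_map_apply]; exact hda₀.map ψ)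
  have hbC : ((b : K) : L) ∈ C := (hC _).2 ⟨hK _ (b : K).2, by rw [hρK]; exact b.2⟩
  let b' : C := ⟨(b : K), hbC⟩
  have hψb : ψ b' = b := Subtype.ext (hρK b)
  have hfb : ψ (f.eval b') = 0 := by
    rw [← Polynomial.eval_map_apply, hψb]; exact hb
  have hdb : IsUnit (f.derivative.eval b') := by
    refine hlocal _ ?_
    by_contra hnu
    have h1 : ψ (f.derivative.eval b') ∈ IsLocalRing.maximalIdeal B' := hnu
    have h2 : ψ (f.derivative.eval b') - ψ (f.derivative.eval a₀) ∈ IsLocalRing.maximalIdeal B' := by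
      rw [← Polynomial.eval_map_apply, ← Polynomial.eval_map_apply, hψb]
      exact Ideal.mem_of_dvd _ (Polynomial.sub_dvd_eval_sub _ _ _) hba
    have h3 := Ideal.sub_mem _ h1 h2
    rw [sub_sub_cancel] at h3
    exact h3 (hda₀.map ψ)
  obtain ⟨a, ha, hab⟩ := hB.is_henselian (f.map ι) (hf.map ι) (ι b')
    (by rw [Polynomial.eval_map_apply, ← hρ0]; exact congrArg Subtype.val hfb)
    (by rw [Polynomial.derivative_map, Polynomial.eval_map_apply]; exact hdb.map ι)
  have hρa : ρ a = b := by
    have := (hρ0 _).2 hab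
    rw [map_sub, sub_eq_zero] at this
    rw [this]
    exact hρK b
  have haC : (a : L) ∈ C := (hC a).2 ⟨a.2, by rw [Subtype.coe_eta, hρa]; exact b.2⟩
  let a' : C := ⟨a, haC⟩
  have hψa : ψ a' = b := Subtype.ext hρa
  refine ⟨a', hι ?_, fun hu => ?_⟩
  · rw [← Polynomial.eval_map_apply, map_zero]
    exact ha
  · have := hu.map ψ
    rw [map_sub, hψa] at this
    exact hba this

/-! ### The descent along henselian coarsenings. -/

section Core

variable {F : Type*} [Field F] [Algebra F L] {O A : ValuationSubring L}
  {ι : Type*} [Fintype ι] {s : ι → L}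

theorem injective_prod_valuation_pow (h0 : ∀ i, s i ≠ 0) (h1 : ∀ i, A.valuation (s i) < 1)
    (hfar : ∀ i j, i ≠ j → FarBelow (A.valuation (s i)) (A.valuation (s j)) ∨
      FarBelow (A.valuation (s j)) (A.valuation (s i))) :
    Function.Injective fun α : ι → ℕ => ∏ i, A.valuation (s i) ^ α i :=
  injective_prod_pow_of_farBelow _ (fun i => by simpa using h0 i) h1 hfar

theorem algebraicIndependent_of_farBelow (hF : ∀ a : F, algebraMap F L a ∈ A)
    (h0 : ∀ i, s i ≠ 0) (h1 : ∀ i, A.valuation (s i) < 1)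
    (hfar : ∀ i j, i ≠ j → FarBelow (A.valuation (s i)) (A.valuation (s j)) ∨
      FarBelow (A.valuation (s j)) (A.valuation (s i))) : AlgebraicIndependent F s :=
  algebraicIndependent_of_injective hF h0 (injective_prod_valuation_pow h0 h1 hfar)

theorem farBelow_or_of_le (hOA : O ≤ A) {x y : L} (hx0 : x ≠ 0) (hx1 : A.valuation x < 1)
    (hy0 : y ≠ 0) (hy1 : A.valuation y < 1)
    (h : FarBelow (O.valuation x) (O.valuation y) ∨ FarBelow (O.valuation y) (O.valuation x)) :
    FarBelow (A.valuation x) (A.valuation y) ∨ FarBelow (A.valuation y) (A.valuation x) :=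
  h.imp (farBelow_of_le hOA hy0 hy1) (farBelow_of_le hOA hx0 hx1)

/-- A family of pairwise far elements as large as the transcendence degree exhausts the
archimedean classes. -/
theorem exists_not_farBelow (hOA : O ≤ A) (hF : ∀ a : F, algebraMap F L a ∈ A)
    (h0 : ∀ i, s i ≠ 0) (h1 : ∀ i, A.valuation (s i) < 1)
    (hfar : ∀ i j, i ≠ j → FarBelow (O.valuation (s i)) (O.valuation (s j)) ∨
      FarBelow (O.valuation (s j)) (O.valuation (s i)))
    (htr : Algebra.trdeg F L ≤ Fintype.card ι) {y : L} (hy0 : y ≠ 0) (hy1 : A.valuation y < 1) :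
    ∃ j, ¬ FarBelow (O.valuation y) (O.valuation (s j)) ∧
      ¬ FarBelow (O.valuation (s j)) (O.valuation y) := by
  by_contra! hcon
  have hcon' : ∀ j, FarBelow (O.valuation y) (O.valuation (s j)) ∨
      FarBelow (O.valuation (s j)) (O.valuation y) := fun j => or_iff_not_imp_left.2 (hcon j)
  -- Adding `y` to the family would give more independent elements than the transcendence degree
  -- allows.
  let s' : Option ι → L := fun i => i.elim y s
  have h0' : ∀ i, s' i ≠ 0 := by rintro (_ | i); exacts [hy0, h0 i]
  have h1' : ∀ i, A.valuation (s' i) < 1 := by rintro (_ | i); exacts [hy1, h1 i]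
  have hind : AlgebraicIndependent F s' := by
    refine algebraicIndependent_of_farBelow hF h0' h1' fun i j hij =>
      farBelow_or_of_le hOA (h0' i) (h1' i) (h0' j) (h1' j) ?_
    rcases i with _ | i <;> rcases j with _ | j
    · exact absurd rfl hij
    · exact hcon' j
    · exact (hcon' i).symm
    · exact hfar i j fun h => hij (congrArg _ h)
  have h := hind.lift_cardinalMk_le_trdeg
  have h2 : (Fintype.card ι + 1 : ℕ) ≤ Fintype.card ι := by
    rw [← Nat.cast_le (α := Cardinal)]
    refine le_trans ?_ htr
    simpa using h
  omega

/-- If a family of pairwise far elements is as large as the transcendence degree, then the residue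
field of a coarsening is algebraic over the subfield generated by the members that are units. -/
theorem isAlgebraic_lift_of_farBelow [CharZero F] {B : ValuationSubring L} (hAB : A ≤ B)
    (hB : HenselianLocalRing B)
    (hF : ∀ a : F, algebraMap F L a ∈ A) (h0 : ∀ i, s i ≠ 0) (h1 : ∀ i, A.valuation (s i) < 1)
    (hfar : ∀ i j, i ≠ j → FarBelow (A.valuation (s i)) (A.valuation (s j)) ∨
      FarBelow (A.valuation (s j)) (A.valuation (s i)))
    (htr : Algebra.trdeg F L ≤ Fintype.card ι) {S : Set ι}
    (hS : ∀ i, i ∈ S ↔ B.valuation (s i) = 1) {E : IntermediateField F L}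
    (hE : E = IntermediateField.adjoin F (Set.range fun j : S => s j)) :
    (∀ x, IsAlgebraic E x → x ∈ B) ∧
      ∀ x ∈ B, ∃ a, IsAlgebraic E a ∧ B.valuation (a - x) < 1 := by
  classical
  have hEB : ∀ x : E, algebraMap E L x ∈ B := by
    rintro ⟨x, hx⟩
    rw [hE] at hx
    exact adjoin_range_le_of_injective hAB hF
      (injective_prod_valuation_pow (fun j : S => h0 j) (fun j => h1 j)
        fun i j hij => hfar i j fun h => hij (Subtype.ext h)) (fun j => (hS j).1 j.2) hx
  refine ⟨fun x => mem_of_isAlgebraic hEB, fun x hx => ?_⟩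
  have : CharZero E := charZero_of_injective_algebraMap (algebraMap F E).injective
  suffices h : ∃ g : Polynomial E, g ≠ 0 ∧ B.valuation (Polynomial.aeval x g) < 1 by
    obtain ⟨g, hg, hgx⟩ := h
    exact exists_isAlgebraic_sub_mem hEB hB hx hg hgx
  -- Otherwise `B` is trivial on `E(x)` with `x` transcendental over `E`. The members outside `S`
  -- are independent over `E(x)` and those in `S` over `F`, so the transcendence degree is at least
  -- `|S| + 1 + |Sᶜ|`, one too many.
  by_contra! hcon
  have hone : ∀ g : Polynomial E, g ≠ 0 → B.valuation (Polynomial.aeval x g) = 1 := by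
    intro g hg
    refine le_antisymm ?_ (hcon g hg)
    rw [valuation_le_one_iff, Polynomial.aeval_eq_sum_range]
    refine B.toSubring.sum_mem fun i _ => ?_
    rw [Algebra.smul_def]
    exact B.mul_mem _ _ (hEB _) (pow_mem hx i)
  have htrans : Transcendental E x := by
    rintro ⟨g, hg, hgx⟩
    have := hone g hg
    rw [hgx, map_zero] at this
    exact zero_ne_one this
  let E₁ : IntermediateField E L := IntermediateField.adjoin E {x}
  have hE₁ : ∀ z : E₁, algebraMap E₁ L z ∈ B := by
    rintro ⟨z, hz⟩
    obtain ⟨p, q, h⟩ := (IntermediateField.mem_adjoin_simple_iff E z).1 hz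
    change z ∈ B
    by_cases hp : p = 0
    · simp [h, hp, B.zero_mem]
    by_cases hq : q = 0
    · simp [h, hq, B.zero_mem]
    rw [← valuation_le_one_iff, h, map_div₀, hone p hp, hone q hq, div_one]
  have hlt : ∀ i : (Sᶜ : Set ι), B.valuation (s i) < 1 := by
    intro i
    refine lt_of_le_of_ne ?_ fun h => i.2 ((hS i).2 h)
    simpa using valuation_le_of_le (x := s i) (y := 1) hAB (by rw [map_one]; exact (h1 i).le)
  have hind₁ : AlgebraicIndependent E₁ fun i : (Sᶜ : Set ι) => s i :=
    algebraicIndependent_of_farBelow hE₁ (fun i => h0 i) hlt fun i j hij =>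
      farBelow_or_of_le hAB (h0 i) (hlt i) (h0 j) (hlt j)
        (hfar i j fun h => hij (Subtype.ext h))
  have hindF : AlgebraicIndependent F fun i : S => s i :=
    algebraicIndependent_of_farBelow hF (fun i => h0 i) (fun i => h1 i) fun i j hij =>
      hfar i j fun h => hij (Subtype.ext h)
  have hindE : AlgebraicIndependent F fun i : S =>
      (⟨s i, hE ▸ IntermediateField.subset_adjoin F _ ⟨i, rfl⟩⟩ : E) :=
    AlgebraicIndependent.of_comp E.val hindF
  have hx1 : 1 ≤ Algebra.trdeg E E₁ := IntermediateField.one_le_trdeg_adjoin_simple htrans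
  have hc₁ : (Fintype.card (Sᶜ : Set ι) : Cardinal) ≤ Algebra.trdeg E₁ L := by
    simpa using hind₁.lift_cardinalMk_le_trdeg
  have hcF : (Fintype.card S : Cardinal) ≤ Algebra.trdeg F E := by
    simpa using hindE.lift_cardinalMk_le_trdeg
  have hsum : ((Fintype.card S + (1 + Fintype.card (Sᶜ : Set ι)) : ℕ) : Cardinal) ≤
      (Fintype.card ι : ℕ) := by
    refine le_trans ?_ htr
    rw [← IntermediateField.trdeg_add_trdeg_eq E, ← IntermediateField.trdeg_add_trdeg_eq E₁]
    push_cast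
    exact add_le_add hcF (add_le_add hx1 hc₁)
  rw [Nat.cast_le, Fintype.card_compl_set] at hsum
  have := set_fintype_card_le_univ S
  omega

/-- Descent along henselian coarsenings. -/
theorem henselian_of_farBelow [CharZero F] (hOA : O ≤ A) (hA : ∀ B, O ≤ B → B ≠ O → A ≤ B)
    (hF : ∀ a : F, algebraMap F L a ∈ A) (h0 : ∀ i, s i ≠ 0) (h1 : ∀ i, A.valuation (s i) < 1)
    (hfar : ∀ i j, i ≠ j → FarBelow (O.valuation (s i)) (O.valuation (s j)) ∨
      FarBelow (O.valuation (s j)) (O.valuation (s i)))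
    (htr : Algebra.trdeg F L ≤ Fintype.card ι)
    (hpro : ∀ S : Set ι, S.Nonempty ∨ A ≠ O → ∃ K : Subfield L,
      (∀ x, x ∈ K ↔ IsAlgebraic (IntermediateField.adjoin F (Set.range fun j : S => s j)) x) ∧
      (O.inter K).HasHenselianCoarsening) :
    HenselianLocalRing O := by
  classical
  -- Elements of the same archimedean class for `O` become units in the same coarsenings.
  have hcomp : ∀ y : L, y ≠ 0 → A.valuation y < 1 → ∃ j,
      (∀ B, O ≤ B → B.valuation y = 1 → B.valuation (s j) = 1) ∧
      (∀ B, O ≤ B → B.valuation y < 1 → B.valuation (s j) < 1) := by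
    intro y hy0 hy1
    obtain ⟨j, hj1, hj2⟩ := exists_not_farBelow hOA hF h0 h1 hfar htr hy0 hy1
    simp only [FarBelow, not_forall, not_lt] at hj1 hj2
    obtain ⟨m, hm⟩ := hj1
    obtain ⟨n, hn⟩ := hj2
    rw [← map_pow] at hm hn
    have hjO : O.valuation (s j) < 1 := valuation_lt_one_of_le hOA (h1 j)
    refine ⟨j, fun B hOB hB => le_antisymm ?_ ?_, fun B hOB hB => ?_⟩
    · simpa using valuation_le_of_le (x := s j) (y := 1) hOB (by rw [map_one]; exact hjO.le)
    · simpa [hB] using valuation_le_of_le hOB hn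
    · have h := (valuation_le_of_le hOB hm).trans_lt hB
      rw [map_pow] at h
      by_contra hge
      exact absurd h (not_lt.2 (one_le_pow_of_one_le' (not_lt.1 hge) m))
  have hfarA : ∀ i j, i ≠ j → FarBelow (A.valuation (s i)) (A.valuation (s j)) ∨
      FarBelow (A.valuation (s j)) (A.valuation (s i)) := fun i j hij =>
    farBelow_or_of_le hOA (h0 i) (h1 i) (h0 j) (h1 j) (hfar i j hij)
  -- Induction on the number of `s i` that are units of `B`. The start is the trivial valuation
  -- ring, where an approximate root is already a root.
  suffices key : ∀ n : ℕ, ∀ B : ValuationSubring L, A ≤ B → HenselianLocalRing B →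
      (Finset.univ.filter fun i => B.valuation (s i) = 1).card = n → HenselianLocalRing O by
    refine key _ ⊤ (le_top A) ?_ rfl
    refine { toIsLocalRing := inferInstance, is_henselian := fun f _ a ha _ => ⟨a, ?_, by simp⟩ }
    have h := (valuation_lt_one_iff _ _).1 ha
    have h0 : (((f.eval a : _) : (⊤ : ValuationSubring L)) : L) = 0 := by
      by_contra hne
      have h2 := ((⊤ : ValuationSubring L).valuation_le_one_iff _).2
        (mem_top (((f.eval a : _) : (⊤ : ValuationSubring L)) : L)⁻¹)
      rw [map_inv₀] at h2
      exact absurd ((one_lt_inv₀ (zero_lt_iff.2 (by simpa using hne))).2 h) (not_lt.2 h2)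
    exact Subtype.ext h0
  intro n
  induction n using Nat.strong_induction_on with
  | _ n ih =>
  intro B hAB hB hn
  have hOB : O ≤ B := hOA.trans hAB
  by_cases hBO : B = O
  · exact hBO ▸ hB
  -- If `A = O`, a nonunit of `O` that is a unit of `B` shares its class with some `s j`, so the
  -- index set is nonempty.
  obtain ⟨K, hK, hKO⟩ := hpro {i | B.valuation (s i) = 1} (by
    rw [or_iff_not_imp_right, not_not]
    intro hAO
    obtain ⟨y, hy0, hy1, hyB⟩ := exists_valuation_lt_one_eq_one hOB (Ne.symm hBO)
    obtain ⟨j, hj, -⟩ := hcomp y hy0 (hAO ▸ hy1)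
    exact ⟨j, hj B hOB hyB⟩)
  obtain ⟨hmem, hlift⟩ := isAlgebraic_lift_of_farBelow hAB hB hF h0 h1 hfarA htr
    (S := {i | B.valuation (s i) = 1}) (fun i => Iff.rfl) rfl
  obtain ⟨C, hOC, hCB, hne, hC⟩ := exists_henselian_refinement hOB hB K
    (fun x hx => hmem x ((hK x).1 hx))
    (fun x hx => (hlift x hx).imp fun a ha => ⟨(hK a).2 ha.1, ha.2⟩) hKO
  by_cases hCO : C = O
  · exact hCO ▸ hC
  have hAC := hA C hOC hCO
  -- The class of an element separating `C` from `B` contains some `s j`, a unit of `B` but not of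
  -- `C`, so the count drops.
  obtain ⟨y, hy0, hyC, hyB⟩ := exists_valuation_lt_one_eq_one hCB hne
  obtain ⟨j, hj1, hj2⟩ := hcomp y hy0 (valuation_lt_one_of_le hAC hyC)
  refine ih _ ?_ C hAC hC rfl
  rw [← hn]
  refine Finset.card_lt_card (Finset.ssubset_iff_of_subset ?_ |>.2 ⟨j, ?_, ?_⟩)
  · intro i hi
    simp only [Finset.mem_filter, Finset.mem_univ, true_and] at hi ⊢
    exact valuation_eq_one_of_le hCB hi
  · simpa using hj1 B hOB hyB
  · simpa using (hj2 C hOC hyC).ne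

end Core

end ValuationSubring

/-! ### Convex subgroups and archimedean classes. -/

section ConvexSubgroup

variable {Γ : Type*} [CommGroup Γ] [LinearOrder Γ] [IsOrderedMonoid Γ]

theorem IsConvexSubgroup.mem_of_le {H : Subgroup Γ} (hH : IsConvexSubgroup H) {a b : Γ}
    (hb : b ∈ H) (hba : b ≤ a) (ha : a ≤ 1) : a ∈ H := by
  rw [← H.inv_mem_iff] at hb ⊢
  exact hH _ _ hb (one_le_inv'.2 ha) (inv_le_inv_iff.2 hba)

/-- A power of `b` at most `a` would put `a` into `H` by convexity. -/
theorem IsConvexSubgroup.farBelow {H : Subgroup Γ} (hH : IsConvexSubgroup H) {a b : Γ}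
    (hb : b ∈ H) (ha : a ∉ H) (ha1 : a < 1) : FarBelow a b := fun n =>
  lt_of_not_ge fun h => ha (hH.mem_of_le (H.pow_mem hb n) h ha1.le)

theorem exists_lt_one_notMem {H H' : Subgroup Γ} (h : ¬ H' ≤ H) :
    ∃ a : Γ, a < 1 ∧ a ∉ H ∧ a ∈ H' := by
  obtain ⟨a, ha', ha⟩ := SetLike.not_le_iff_exists.1 h
  rcases lt_trichotomy a 1 with h1 | h1 | h1
  · exact ⟨a, h1, ha, ha'⟩
  · exact absurd (h1 ▸ H.one_mem) ha
  · exact ⟨a⁻¹, inv_lt_one'.2 h1, by rwa [H.inv_mem_iff], H'.inv_mem ha'⟩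

theorem IsConvexSubgroup.le_total {H H' : Subgroup Γ} (hH : IsConvexSubgroup H)
    (hH' : IsConvexSubgroup H') : H ≤ H' ∨ H' ≤ H := by
  by_contra! h
  obtain ⟨a, ha1, haH', haH⟩ := exists_lt_one_notMem h.1
  obtain ⟨b, hb1, hbH, hbH'⟩ := exists_lt_one_notMem h.2
  rcases _root_.le_total a b with hab | hab
  · exact hbH (hH.mem_of_le haH hab hb1.le)
  · exact haH' (hH'.mem_of_le hbH' hab ha1.le)

/-- A set of `n` proper convex subgroups gives `n` pairwise far elements. -/
theorem exists_pairwise_farBelow {𝒮 : Set (Subgroup Γ)}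
    (h𝒮 : ∀ H ∈ 𝒮, IsConvexSubgroup H ∧ H ≠ ⊤) {n : ℕ} (hn : (n : ℕ∞) ≤ 𝒮.encard) :
    ∃ g : Fin n → Γ, (∀ i, g i < 1) ∧ (∀ i, ∃ H ∈ 𝒮, g i ∉ H) ∧
      ∀ i j, i ≠ j → FarBelow (g i) (g j) ∨ FarBelow (g j) (g i) := by
  classical
  obtain ⟨T, hT𝒮, hT⟩ := Set.exists_subset_encard_eq hn
  have hfin : T.Finite := Set.finite_of_encard_eq_coe hT
  have key : ∀ H : T, ∃ a : Γ, a < 1 ∧ a ∉ H.1 ∧ ∀ H' ∈ T, H.1 < H' → a ∈ H' := by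
    -- Choose `a` outside `H` but in the next larger member of `T`, or anywhere outside `H` if `H`
    -- is the largest.
    rintro ⟨H, hH⟩
    by_cases hne : {H' ∈ T | H < H'}.Nonempty
    · obtain ⟨M, hM⟩ := (hfin.subset (Set.sep_subset T _)).exists_minimal hne
      obtain ⟨a, ha1, haH, haM⟩ := exists_lt_one_notMem (not_le_of_gt hM.prop.2)
      refine ⟨a, ha1, haH, fun H' hH' hlt => ?_⟩
      rcases (h𝒮 M (hT𝒮 hM.prop.1)).1.le_total (h𝒮 H' (hT𝒮 hH')).1 with h | h
      · exact h haM
      · exact hM.le_of_le ⟨hH', hlt⟩ h haM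
    · obtain ⟨a, ha1, haH, -⟩ := exists_lt_one_notMem
        (fun h => (h𝒮 H (hT𝒮 hH)).2 (top_le_iff.1 h) : ¬ (⊤ : Subgroup Γ) ≤ H)
      exact ⟨a, ha1, haH, fun H' hH' hlt => absurd ⟨H', hH', hlt⟩ hne⟩
  choose g hg1 hgH hg using key
  have := hfin.fintype
  have hcard : Fintype.card T = n := by
    rw [Set.encard_eq_coe_toFinset_card, Nat.cast_inj, Set.toFinset_card] at hT
    exact hT
  let e : Fin n ≃ T := (Fintype.equivFinOfCardEq hcard).symm
  refine ⟨fun i => g (e i), fun i => hg1 _, fun i => ⟨_, hT𝒮 (e i).2, hgH _⟩, fun i j hij => ?_⟩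
  have hne : (e i : Subgroup Γ) ≠ e j := fun h => hij (e.injective (Subtype.ext h))
  rcases (h𝒮 _ (hT𝒮 (e i).2)).1.le_total (h𝒮 _ (hT𝒮 (e j).2)).1 with h | h
  · exact Or.inr ((h𝒮 _ (hT𝒮 (e j).2)).1.farBelow (hg _ _ (e j).2 (lt_of_le_of_ne h hne))
      (hgH _) (hg1 _))
  · exact Or.inl ((h𝒮 _ (hT𝒮 (e i).2)).1.farBelow (hg _ _ (e i).2 (lt_of_le_of_ne h hne.symm))
      (hgH _) (hg1 _))

/-- The convex subgroup generated by an element `a ≤ 1`. -/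
def convexClosure (a : Γ) : Subgroup Γ where
  carrier := {x | ∃ n : ℕ, a ^ n ≤ x ∧ x ≤ (a ^ n)⁻¹}
  one_mem' := ⟨0, by simp⟩
  mul_mem' := by
    rintro x y ⟨m, hm, hm'⟩ ⟨n, hn, hn'⟩
    refine ⟨m + n, ?_, ?_⟩
    · rw [pow_add]; exact mul_le_mul' hm hn
    · rw [pow_add, mul_inv]; exact mul_le_mul' hm' hn'
  inv_mem' := by
    rintro x ⟨n, hn, hn'⟩
    exact ⟨n, le_inv'.1 hn', inv_le_inv_iff.2 hn⟩

theorem isConvexSubgroup_convexClosure (a : Γ) (ha : a ≤ 1) :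
    IsConvexSubgroup (convexClosure a) := by
  rintro x y ⟨n, -, hn⟩ hx hxy
  exact ⟨n, (pow_le_one' ha n).trans hx, hxy.trans hn⟩

theorem convexClosure_ne_bot {a : Γ} (ha : a < 1) : convexClosure a ≠ ⊥ := by
  intro h
  have : a ∈ convexClosure a :=
    ⟨1, by simp, by simpa using ha.le.trans (one_le_inv'.2 ha.le)⟩
  rw [h, Subgroup.mem_bot] at this
  exact ha.ne this

/-- In an ordered group of rank one every element is bounded by powers of any `a < 1`. -/
theorem exists_pow_le_of_convexRank_eq_one (h : convexRank Γ = 1) {a : Γ} (ha : a < 1) (x : Γ) :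
    ∃ n : ℕ, a ^ n ≤ x := by
  have htop : convexClosure a = ⊤ := by
    by_contra hne
    have hbot : (⊥ : Subgroup Γ) ≠ ⊤ := fun h =>
      ha.ne (Subgroup.mem_bot.1 (h ▸ Subgroup.mem_top a))
    refine convexClosure_ne_bot ha (Set.encard_le_one_iff.1 h.le _ _
      ⟨isConvexSubgroup_convexClosure a ha.le, hne⟩ ⟨?_, hbot⟩)
    intro x y hy hx hxy
    rw [Subgroup.mem_bot] at hy ⊢
    exact le_antisymm (hxy.trans hy.le) hx
  obtain ⟨n, hn, -⟩ : x ∈ convexClosure a := htop ▸ Subgroup.mem_top x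
  exact ⟨n, hn⟩

end ConvexSubgroup

/-! ### Far families in `L` and the prohenselian property. -/

namespace ValuationSubring

variable {L : Type*} [Field L] {O : ValuationSubring L}

theorem exists_unit_eq_valuation (O : ValuationSubring L) {x : L} (hx : x ≠ 0) :
    ∃ u : (O.ValueGroup)ˣ, (u : O.ValueGroup) = O.valuation x :=
  ⟨Units.mk0 _ (by simpa using hx), rfl⟩

theorem farBelow_val {a b : (O.ValueGroup)ˣ} (h : FarBelow a b) :
    FarBelow (a : O.ValueGroup) (b : O.ValueGroup) := fun n => by
  have := Units.val_lt_val.2 (h n)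
  rwa [Units.val_pow_eq_pow_val] at this

theorem exists_family_farBelow {𝒮 : Set (Subgroup (O.ValueGroup)ˣ)}
    (h𝒮 : ∀ H ∈ 𝒮, IsConvexSubgroup H ∧ H ≠ ⊤) {n : ℕ} (hn : (n : ℕ∞) ≤ 𝒮.encard) :
    ∃ s : Fin n → L, (∀ i, s i ≠ 0) ∧ (∀ i, O.valuation (s i) < 1) ∧
      (∀ i, ∃ H ∈ 𝒮, ∃ u ∉ H, (u : O.ValueGroup) = O.valuation (s i)) ∧
      ∀ i j, i ≠ j → FarBelow (O.valuation (s i)) (O.valuation (s j)) ∨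
        FarBelow (O.valuation (s j)) (O.valuation (s i)) := by
  obtain ⟨g, hg1, hgH, hg⟩ := exists_pairwise_farBelow h𝒮 hn
  choose s hs using fun i => O.valuation_surjective (g i : O.ValueGroup)
  refine ⟨s, fun i h0 => ?_, fun i => ?_, fun i => ?_, fun i j hij => ?_⟩
  · have := hs i
    rw [h0, map_zero] at this
    exact (g i).ne_zero this.symm
  · rw [hs]; exact_mod_cast hg1 i
  · obtain ⟨H, hH, h⟩ := hgH i
    exact ⟨H, hH, g i, h, (hs i).symm⟩
  · rw [hs, hs]
    exact (hg i j hij).imp farBelow_val farBelow_val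

theorem muchLess_of_farBelow {r t : L} (ht : O.valuation t < 1)
    (h : FarBelow (O.valuation t) (O.valuation r)) : O.MuchLess r t := by
  refine ⟨?_, h.lt⟩
  rintro ⟨n, hn, ⟨-, h2⟩ | ⟨h1, -⟩⟩
  · rw [map_pow] at h2
    exact absurd (h (n + 1)) (not_lt.2 h2)
  · rw [map_pow] at h1
    exact absurd (h1.trans ((pow_le_pow_right_of_le_one' ht.le hn).trans_eq (pow_one _))) (not_le.2 h.lt)

/-- The defining property of prohenselian valuation rings, for unordered sets. -/
theorem IsProhenselian.hasHenselianCoarsening [CharZero L] (hpro : O.IsProhenselian) {T : Set L}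
    (hfin : T.Finite) (hne : T.Nonempty) (hT : ∀ x ∈ T, x ≠ 0 ∧ O.valuation x < 1)
    (hfar : T.Pairwise fun x y => FarBelow (O.valuation x) (O.valuation y) ∨
      FarBelow (O.valuation y) (O.valuation x)) :
    (O.inter (relAlgClosure T)).HasHenselianCoarsening := by
  have := hfin.fintype
  -- The order is dual because `≪` lists elements by decreasing multiplicative value.
  let f : T → (O.ValueGroup)ᵒᵈ := fun x => OrderDual.toDual (O.valuation x)
  have hf : Function.Injective f := by
    intro x y hxy
    by_contra hne
    have hxy' : O.valuation x = O.valuation y := hxy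
    rcases hfar x.2 y.2 (fun h => hne (Subtype.ext h)) with h | h
    · exact h.lt.ne hxy'
    · exact h.lt.ne' hxy'
  let : LinearOrder T := LinearOrder.lift' f hf
  let e : Fin (Fintype.card T) ≃o T := Fintype.orderIsoFinOfCardEq T rfl
  have hrange : Set.range (fun i => (e i : L)) = T := by
    ext x
    exact ⟨by rintro ⟨i, rfl⟩; exact (e i).2, fun hx => ⟨e.symm ⟨x, hx⟩, by simp⟩⟩
  have := hpro (Fintype.card T) (Fintype.card T) (Fintype.card_pos_iff.2 hne.to_subtype) le_rfl
    (fun i => e i) (fun i => hT _ (e i).2) fun i j hij => ?_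
  · rwa [hrange] at this
  · have hlt : O.valuation (e j) < O.valuation (e i) := e.strictMono hij
    refine muchLess_of_farBelow (hT _ (e j).2).2 ?_
    refine (hfar (e j).2 (e i).2 fun h => ?_).resolve_right fun h => absurd h.lt hlt.not_gt
    rw [h] at hlt
    exact lt_irrefl _ hlt

theorem mem_relAlgClosure_iff [CharZero L] {T : Set L} {x : L} :
    x ∈ relAlgClosure T ↔ IsAlgebraic (IntermediateField.adjoin ℚ T) x :=
  mem_algebraicClosure_iff

/-- The coarsening in which `π` becomes a unit. -/
theorem exists_coarsening_mem_iff (O : ValuationSubring L) {π : L} (hπ : O.valuation π ≤ 1) :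
    ∃ A : ValuationSubring L, O ≤ A ∧
      ∀ x, x ∈ A ↔ ∃ n : ℕ, O.valuation x * O.valuation π ^ n ≤ 1 := by
  let R : Subring L :=
    { carrier := {x | ∃ n : ℕ, O.valuation x * O.valuation π ^ n ≤ 1}
      zero_mem' := ⟨0, by simp⟩
      one_mem' := ⟨0, by simp⟩
      neg_mem' := by rintro x ⟨n, hn⟩; exact ⟨n, by rwa [Valuation.map_neg]⟩
      mul_mem' := by
        rintro x y ⟨m, hm⟩ ⟨n, hn⟩
        refine ⟨m + n, ?_⟩
        rw [map_mul, pow_add, mul_mul_mul_comm]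
        exact mul_le_one' hm hn
      add_mem' := by
        rintro x y ⟨m, hm⟩ ⟨n, hn⟩
        refine ⟨m + n, ?_⟩
        rw [← map_pow, ← map_mul, add_mul]
        refine Valuation.map_add_le _ ?_ ?_
        · rw [map_mul, map_pow, pow_add, ← mul_assoc]
          exact mul_le_one' hm (pow_le_one' hπ n)
        · rw [map_mul, map_pow, pow_add, mul_left_comm, mul_comm]
          exact mul_le_one' hn (pow_le_one' hπ m) }
  have hle : O.toSubring ≤ R := fun x hx => ⟨0, by simpa using hx⟩
  exact ⟨ofLE O R hle, hle, fun x => Iff.rfl⟩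

/-- The main argument for an element `π` of the smallest archimedean class. -/
theorem henselian_of_smallest_class [CharZero L] (hpro : O.IsProhenselian) {π : L} (hπ0 : π ≠ 0)
    (hπ1 : O.valuation π < 1)
    (hmin : ∀ y : L, y ≠ 0 → O.valuation y < 1 → ∃ n : ℕ, O.valuation y ^ n ≤ O.valuation π)
    (hF : ∀ x ∈ IntermediateField.adjoin ℚ {π}, ∃ n : ℕ, O.valuation x * O.valuation π ^ n ≤ 1)
    {ι : Type*} [Fintype ι] {s : ι → L} (h0 : ∀ i, s i ≠ 0)
    (hfarπ : ∀ i, FarBelow (O.valuation (s i)) (O.valuation π))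
    (hfar : ∀ i j, i ≠ j → FarBelow (O.valuation (s i)) (O.valuation (s j)) ∨
      FarBelow (O.valuation (s j)) (O.valuation (s i)))
    (htr : Algebra.trdeg (IntermediateField.adjoin ℚ {π}) L ≤ Fintype.card ι) :
    HenselianLocalRing O := by
  obtain ⟨A, hOA, hA⟩ := O.exists_coarsening_mem_iff hπ1.le
  refine henselian_of_farBelow (F := IntermediateField.adjoin ℚ {π}) (A := A) (s := s) hOA ?_
    (fun a => (hA _).2 (hF _ a.2)) h0 ?_ hfar htr fun S _ => ?_
  -- `A` is the least proper coarsening: a nonunit of `O` that is a unit of `B` has a power of value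
  -- at most that of `π`, which makes `π` a unit of `B`.
  · intro B hOB hBO x hx
    obtain ⟨n, hn⟩ := (hA x).1 hx
    obtain ⟨y, hy0, hy1, hyB⟩ := exists_valuation_lt_one_eq_one hOB hBO.symm
    obtain ⟨m, hm⟩ := hmin y hy0 hy1
    have hπB : B.valuation π = 1 := by
      refine le_antisymm ?_ ?_
      · simpa using valuation_le_of_le (x := π) (y := 1) hOB (by rw [map_one]; exact hπ1.le)
      · rw [← map_pow] at hm
        simpa [hyB] using valuation_le_of_le hOB hm
    have h := valuation_le_of_le (x := x * π ^ n) (y := 1) hOB (by simpa using hn)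
    rw [map_mul, map_pow, hπB, one_pow, mul_one, map_one] at h
    exact (B.valuation_le_one_iff x).1 h
  · intro i
    have hnot : (s i)⁻¹ ∉ A := by
      rw [hA]
      rintro ⟨n, hn⟩
      rw [map_inv₀, inv_mul_le_one₀ (zero_lt_iff.2 (by simpa using h0 i))] at hn
      exact absurd (hfarπ i n) (not_lt.2 hn)
    rw [← valuation_le_one_iff, not_le, map_inv₀,
      one_lt_inv₀ (zero_lt_iff.2 (by simpa using h0 i))] at hnot
    exact hnot
  -- `π` always belongs to the generating set, so `S` may be empty.
  · refine ⟨relAlgClosure ({π} ∪ Set.range fun j : S => s j), fun x => ?_, ?_⟩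
    · rw [mem_relAlgClosure_iff, ← IntermediateField.adjoin_adjoin_left]
      rfl
    · refine hpro.hasHenselianCoarsening ((Set.finite_singleton π).union (Set.finite_range _))
        ⟨π, Or.inl rfl⟩ ?_ ?_
      · rintro x (rfl | ⟨j, rfl⟩)
        · exact ⟨hπ0, hπ1⟩
        · exact ⟨h0 j, by simpa using hfarπ j 0⟩
      · rintro x (rfl | ⟨i, rfl⟩) y (rfl | ⟨j, rfl⟩) hxy
        · exact absurd rfl hxy
        · exact Or.inr (hfarπ j)
        · exact Or.inl (hfarπ i)
        · exact hfar i j fun h => hxy (by simp only [h])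

/-- The case of residue characteristic zero. -/
theorem henselian_of_natCast_unit [CharZero L] (hpro : O.IsProhenselian)
    (hchar : ∀ m : ℕ, m ≠ 0 → O.valuation (m : L) = 1) {n : ℕ}
    (htr : Algebra.trdeg ℚ L ≤ n) (hn : (n : ℕ∞) ≤ O.valueRank) : HenselianLocalRing O := by
  obtain ⟨s, h0, h1, -, hfar⟩ := exists_family_farBelow (O := O) (fun H hH => hH) hn
  refine henselian_of_farBelow (F := ℚ) (A := O) (s := s) le_rfl (fun B hB _ => hB) ?_ h0 h1 hfar
    (by simpa using htr) fun S hS => ?_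
  · intro q
    have hint : ∀ z : ℤ, O.valuation (z : L) ≤ 1 := fun z =>
      (O.valuation_le_one_iff _).2 (intCast_mem O z)
    rw [← valuation_le_one_iff, eq_ratCast, Rat.cast_def, map_div₀, hchar _ q.den_nz, div_one]
    exact hint _
  · refine ⟨relAlgClosure (Set.range fun j : S => s j), fun x => mem_relAlgClosure_iff, ?_⟩
    obtain ⟨j, hj⟩ := hS.resolve_right (by simp)
    refine hpro.hasHenselianCoarsening (Set.finite_range _) ⟨_, ⟨j, hj⟩, rfl⟩ ?_ ?_
    · rintro x ⟨i, rfl⟩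
      exact ⟨h0 i, h1 i⟩
    · rintro x ⟨i, rfl⟩ y ⟨j, rfl⟩ hxy
      exact hfar i j fun h => hxy (by simp only [h])

/-! ### Tightness and residue characteristic `p`. -/

theorem IsTight.exists_unit {p : ℕ} (h : O.IsTight p) :
    ∃ γ : (O.ValueGroup)ˣ, (γ : O.ValueGroup) = O.valuation (p : L) ∧
      ∀ H : Subgroup (O.ValueGroup)ˣ, IsConvexSubgroup H → H ≠ ⊥ → γ ∈ H := by
  obtain ⟨H, hH, γ, hγ, hγp⟩ := h
  exact ⟨γ, hγp, fun H' h1 h2 => hH.2 ⟨h1, h2⟩ hγ⟩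

/-- The value of `p` lies in every nontrivial convex subgroup, in particular in the one generated by
the value of `y`. -/
theorem IsTight.exists_pow_le {p : ℕ} (h : O.IsTight p) {y : L} (hy0 : y ≠ 0)
    (hy1 : O.valuation y < 1) : ∃ n : ℕ, O.valuation y ^ n ≤ O.valuation (p : L) := by
  obtain ⟨γ, hγ, hmem⟩ := h.exists_unit
  obtain ⟨u, hu⟩ := O.exists_unit_eq_valuation hy0
  have hu1 : u < 1 := by
    rw [← Units.val_lt_val, hu]; exact hy1
  obtain ⟨n, hn, -⟩ := hmem _ (isConvexSubgroup_convexClosure u hu1.le) (convexClosure_ne_bot hu1)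
  refine ⟨n, ?_⟩
  rw [← hu, ← hγ]
  exact_mod_cast hn

/-- In a tight valuation ring of rank greater than `n` there are `n` pairwise far elements above the
archimedean class of `p`. -/
theorem IsTight.exists_family_farBelow {p : ℕ} (h : O.IsTight p) {n : ℕ}
    (hn : ((n + 1 : ℕ) : ℕ∞) ≤ O.valueRank) :
    ∃ s : Fin n → L, (∀ i, s i ≠ 0) ∧
      (∀ i, FarBelow (O.valuation (s i)) (O.valuation (p : L))) ∧
      ∀ i j, i ≠ j → FarBelow (O.valuation (s i)) (O.valuation (s j)) ∨
        FarBelow (O.valuation (s j)) (O.valuation (s i)) := by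
  -- Discarding the trivial subgroup costs one; all others contain the value of `p`, so nonunits
  -- with values outside them are far below `p`.
  have hn' : (n : ℕ∞) ≤ ({H : Subgroup (O.ValueGroup)ˣ | IsConvexSubgroup H ∧ H ≠ ⊤} \ {⊥}).encard := by
    have h1 := hn.trans (Set.encard_le_encard_sdiff_add_encard _ {(⊥ : Subgroup (O.ValueGroup)ˣ)})
    rw [Set.encard_singleton, Nat.cast_add, Nat.cast_one] at h1
    exact (ENat.add_le_add_iff_right ENat.one_ne_top).1 h1
  obtain ⟨γ, hγ, hmem⟩ := h.exists_unit
  obtain ⟨s, h0, h1, hH, hfar⟩ := ValuationSubring.exists_family_farBelow (fun H hH => hH.1) hn'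
  refine ⟨s, h0, fun i => ?_, hfar⟩
  obtain ⟨H, hH, u, hu, hus⟩ := hH i
  rw [← hus, ← hγ]
  refine farBelow_val (hH.1.1.farBelow (hmem H hH.1.1 hH.2) hu ?_)
  rw [← Units.val_lt_val, hus]
  exact h1 i

section ResidueChar

variable {p : ℕ} [CharP (IsLocalRing.ResidueField O) p]

theorem valuation_natCast_lt_one_iff (m : ℕ) : O.valuation (m : L) < 1 ↔ p ∣ m := by
  rw [← CharP.cast_eq_zero_iff (IsLocalRing.ResidueField O) p, ← map_natCast (IsLocalRing.residue O),
    IsLocalRing.residue_eq_zero_iff, valuation_lt_one_iff]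
  simp

/-- Divide by `p` until a unit remains. -/
theorem exists_pow_le_valuation_natCast [CharZero L] {m : ℕ} (hm : m ≠ 0) :
    ∃ n : ℕ, O.valuation (p : L) ^ n ≤ O.valuation (m : L) := by
  induction m using Nat.strong_induction_on with
  | _ m ih =>
  by_cases h : O.valuation (m : L) < 1
  · obtain ⟨k, rfl⟩ := (valuation_natCast_lt_one_iff (p := p) m).1 h
    have hp1 : p ≠ 1 := CharP.char_ne_one (IsLocalRing.ResidueField O) p
    have hp0 : p ≠ 0 := left_ne_zero_of_mul hm
    have hk : k ≠ 0 := right_ne_zero_of_mul hm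
    obtain ⟨n, hn⟩ := ih k (by
      have : 2 ≤ p := by omega
      nlinarith [Nat.pos_of_ne_zero hk]) hk
    refine ⟨n + 1, ?_⟩
    rw [pow_succ', Nat.cast_mul, map_mul]
    exact mul_le_mul_right hn _
  · exact ⟨0, by simpa using h⟩

end ResidueChar

theorem inter_valuation_le_iff (O : ValuationSubring L) (K : Subfield L) (x y : K) :
    (O.inter K).valuation x ≤ (O.inter K).valuation y ↔
      O.valuation (x : L) ≤ O.valuation (y : L) := by
  by_cases hy : y = 0
  · simp [hy]
  have h1 : (O.inter K).valuation (x / y) ≤ 1 ↔ O.valuation ((x / y : K) : L) ≤ 1 := by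
    rw [valuation_le_one_iff, valuation_le_one_iff]
    rfl
  rw [map_div₀, div_le_one₀ (zero_lt_iff.2 (by simpa using hy)), Subfield.coe_div, map_div₀,
    div_le_one₀ (zero_lt_iff.2 (by simpa using hy))] at h1
  exact h1

theorem exists_pow_le_of_inter_valueRank_eq_one {K : Subfield L} (h : (O.inter K).valueRank = 1)
    {a x : L} (haK : a ∈ K) (hxK : x ∈ K) (ha0 : a ≠ 0) (ha1 : O.valuation a < 1) (hx0 : x ≠ 0) :
    ∃ n : ℕ, O.valuation a ^ n ≤ O.valuation x := by
  obtain ⟨u, hu⟩ := (O.inter K).exists_unit_eq_valuation (x := ⟨a, haK⟩)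
    fun h => ha0 (congrArg Subtype.val h)
  obtain ⟨w, hw⟩ := (O.inter K).exists_unit_eq_valuation (x := ⟨x, hxK⟩)
    fun h => hx0 (congrArg Subtype.val h)
  have hu1 : u < 1 := by
    rw [← Units.val_lt_val, hu, Units.val_one, ← map_one (O.inter K).valuation, ← not_le,
      inter_valuation_le_iff]
    simpa using ha1
  obtain ⟨n, hn⟩ := exists_pow_le_of_convexRank_eq_one h hu1 w
  refine ⟨n, ?_⟩
  rw [← Units.val_le_val, Units.val_pow_eq_pow_val, hu, hw, ← map_pow, inter_valuation_le_iff] at hn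
  simpa using hn

/-- The case of residue characteristic `p` where the rank exceeds the transcendence degree. -/
theorem IsTight.henselian_of_trdeg_lt_valueRank [CharZero L] (hpro : O.IsProhenselian) {p : ℕ}
    [CharP (IsLocalRing.ResidueField O) p] (hp : p ≠ 0) (hp' : O.IsTight p) {d : ℕ}
    (hd : Algebra.trdeg ℚ L ≤ d) (hrk : ((d + 1 : ℕ) : ℕ∞) ≤ O.valueRank) :
    HenselianLocalRing O := by
  obtain ⟨s, h0, hfarp, hfar⟩ := hp'.exists_family_farBelow hrk
  refine henselian_of_smallest_class hpro (π := (p : L)) (Nat.cast_ne_zero.2 hp)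
    ((valuation_natCast_lt_one_iff p).2 dvd_rfl) (fun y => hp'.exists_pow_le) ?_ h0 hfarp hfar ?_
  · intro x hx
    -- With `π = p` the base field is `ℚ`, and a power of `p` clears the value of any denominator.
    have hbot : IntermediateField.adjoin ℚ {(p : L)} = ⊥ :=
      IntermediateField.adjoin_simple_eq_bot_iff.2 (natCast_mem _ p)
    rw [hbot, IntermediateField.mem_bot] at hx
    obtain ⟨q, rfl⟩ := hx
    obtain ⟨n, hn⟩ := exists_pow_le_valuation_natCast (O := O) (p := p) q.den_nz
    refine ⟨n, ?_⟩
    have hnum : O.valuation (q.num : L) ≤ 1 := (O.valuation_le_one_iff _).2 (intCast_mem O _)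
    have hden : O.valuation (q.den : L) ≠ 0 := by simp
    rw [eq_ratCast, Rat.cast_def, map_div₀]
    calc O.valuation (q.num : L) / O.valuation (q.den : L) * O.valuation (p : L) ^ n
        ≤ 1 / O.valuation (q.den : L) * O.valuation (q.den : L) := by
          gcongr
          exact zero_le
      _ = 1 := by rw [one_div, inv_mul_cancel₀ hden]
  · rw [Fintype.card_fin]
    refine le_trans ?_ hd
    rw [← IntermediateField.trdeg_add_trdeg_eq (IntermediateField.adjoin ℚ {(p : L)})]
    exact le_add_self

/-- The case of residue characteristic `p` where some transcendental element lies in the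
archimedean class of `p`. -/
theorem IsTight.henselian_of_exists_transcendental [CharZero L] (hpro : O.IsProhenselian) {p : ℕ}
    [CharP (IsLocalRing.ResidueField O) p] (hp : p ≠ 0) (hp' : O.IsTight p) {d : ℕ}
    (hd : Algebra.trdeg ℚ L = d) (hrk : (d : ℕ∞) ≤ O.valueRank) {t : L} (ht : Transcendental ℚ t)
    (ht1 : (O.inter (relAlgClosure {t})).valueRank = 1) : HenselianLocalRing O := by
  have hp0 : (p : L) ≠ 0 := Nat.cast_ne_zero.2 hp
  have hp1 : O.valuation (p : L) < 1 := (valuation_natCast_lt_one_iff p).2 dvd_rfl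
  have htK : t ∈ relAlgClosure {t} := mem_relAlgClosure_iff.2
    (isAlgebraic_algebraMap (⟨t, IntermediateField.mem_adjoin_simple_self ℚ t⟩ :
      IntermediateField.adjoin ℚ {t}))
  -- Either `p * t` or `t⁻¹` is a transcendental nonunit; rank one then puts it in the class of `p`.
  obtain ⟨π, hπ, hπK, hπ1⟩ : ∃ π : L, Transcendental ℚ π ∧ π ∈ relAlgClosure {t} ∧
      O.valuation π < 1 := by
    rcases le_or_gt (O.valuation t) 1 with h | h
    · refine ⟨p * t, fun halg => ht ?_, (relAlgClosure {t}).mul_mem (natCast_mem _ p) htK, ?_⟩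
      · have := (isAlgebraic_natCast (R := ℚ) (A := L) p).inv.mul halg
        rwa [inv_mul_cancel_left₀ hp0] at this
      · rw [map_mul]
        exact mul_lt_one_of_lt_of_le hp1 h
    · refine ⟨t⁻¹, fun halg => ht (by simpa using halg.inv), inv_mem htK, ?_⟩
      rw [map_inv₀]
      exact inv_lt_one_of_one_lt₀ h
  have hπ0 : π ≠ 0 := fun h => hπ (h ▸ isAlgebraic_zero)
  obtain ⟨m, hm⟩ := exists_pow_le_of_inter_valueRank_eq_one ht1 (natCast_mem _ p) hπK hp0 hp1 hπ0
  have hpos := IntermediateField.one_le_trdeg_adjoin_simple hπ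
  have hadd := IntermediateField.trdeg_add_trdeg_eq (IntermediateField.adjoin ℚ {π})
  rw [hd] at hadd
  obtain ⟨e, he⟩ := Cardinal.lt_aleph0.1 (lt_of_le_of_lt (le_self_add.trans hadd.le)
    (Cardinal.natCast_lt_aleph0 (n := d)))
  obtain ⟨n, hn⟩ := Cardinal.lt_aleph0.1 (lt_of_le_of_lt (le_add_self.trans hadd.le)
    (Cardinal.natCast_lt_aleph0 (n := d)))
  -- Adjoining `π` lowers the transcendence degree by at least one, which pays for the discarded
  -- trivial subgroup.
  have hend : n + 1 ≤ d := by
    rw [he] at hpos hadd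
    rw [hn] at hadd
    norm_cast at hpos hadd
    omega
  obtain ⟨s, h0, hfarp, hfar⟩ := hp'.exists_family_farBelow
    (n := n) ((Nat.cast_le.2 hend).trans hrk)
  refine henselian_of_smallest_class hpro hπ0 hπ1 ?_ ?_ h0 (fun i k => ?_) hfar (by simp [hn])
  · intro y hy0 hy1
    obtain ⟨k, hk⟩ := hp'.exists_pow_le hy0 hy1
    exact ⟨k * m, by rw [pow_mul]; exact (pow_le_pow_left' hk m).trans hm⟩
  -- `ℚ(π)` lies in the rank one field `ℚ(t)^L`, so powers of `π⁻¹` bound its elements.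
  · intro x hx
    have hxK : x ∈ relAlgClosure {t} := by
      have hle : IntermediateField.adjoin ℚ {π} ≤
          (algebraicClosure (IntermediateField.adjoin ℚ {t}) L).restrictScalars ℚ :=
        IntermediateField.adjoin_le_iff.2 (Set.singleton_subset_iff.2 hπK)
      exact hle hx
    by_cases hx0 : x = 0
    · exact ⟨0, by simp [hx0]⟩
    obtain ⟨k, hk⟩ := exists_pow_le_of_inter_valueRank_eq_one ht1 hπK (inv_mem hxK) hπ0 hπ1
      (inv_ne_zero hx0)
    refine ⟨k, ?_⟩
    rw [map_inv₀] at hk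
    calc O.valuation x * O.valuation π ^ k ≤ O.valuation x * (O.valuation x)⁻¹ := by gcongr
      _ = 1 := mul_inv_cancel₀ (by simpa using hx0)
  · refine (hfarp i (m * k)).trans_le ?_
    rw [pow_mul]
    exact pow_le_pow_left' hm k

end ValuationSubring

theorem mainTheorem4 {L : Type*} [Field L] [CharZero L]
    (hfin : Algebra.trdeg ℚ L < Cardinal.aleph0)
    (O : ValuationSubring L) (hO : O ≠ ⊤)
    (hflat : O.IsFlat) (hpro : O.IsProhenselian) :
    HenselianLocalRing O := by
  obtain ⟨d, hd⟩ := Cardinal.lt_aleph0.1 hfin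
  obtain ⟨hrk, hflat⟩ := hflat
  rw [hd, Cardinal.toENat_nat] at hrk hflat
  obtain ⟨p, hp⟩ := CharP.exists (IsLocalRing.ResidueField O)
  rcases Nat.eq_zero_or_pos p with rfl | hp0
  · refine ValuationSubring.henselian_of_natCast_unit hpro (fun m hm => ?_) hd.le hrk
    refine ((O.valuation_le_one_iff _).2 (natCast_mem O m)).eq_or_lt.resolve_right fun h => hm ?_
    exact Nat.zero_dvd.1 ((ValuationSubring.valuation_natCast_lt_one_iff (p := 0) m).1 h)
  · obtain ⟨htight, htrans⟩ := hflat p hp0 hp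
    rcases eq_or_lt_of_le hrk with h | h
    · obtain ⟨t, ht, ht1⟩ := htrans h.symm
      exact htight.henselian_of_exists_transcendental hpro hp0.ne' hd hrk ht ht1
    · exact htight.henselian_of_trdeg_lt_valueRank hpro hp0.ne' hd.le
        (by push_cast; exact Order.add_one_le_of_lt h)
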